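/- Let $n \ge 0$ and let $M$ be a topological $n$-manifold, with or without boundary, i.e. a second-countable Hausdorff space in which every point has an open neighbourhood homeomorphic to an open subset of $\mathbb{R}^n$ or of a closed half-space of $\mathbb{R}^n$. (1) $M$ is an absolute neighbourhood retract (ANR): for every paracompact Hausdorff space $P$, every closed subset $A \subseteq P$ and every continuous map $f\colon A \to M$, there are an open set $W \subseteq P$ with $A \subseteq W$ and a continuous map $\overline{f}\colon W \to M$ with $\overline{f}|_A = f$. (2) $M$ is a Euclidean neighbourhood retract (ENR), i.e. there exist an $N$, a closed embedding $\iota\colon M \hookrightarrow \mathbb{R}^{N}$, an open set $U \subseteq \mathbb{R}^{N}$ with $\iota(M) \subseteq U$ and a continuous map $r\colon U \to \iota(M)$ with $r|_{\iota(M)} = \mathrm{id}_{\iota(M)}$. Moreover, one can take $N = 2n+1$. -/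

import Mathlib

/-- `M` is a topological `n`-manifold, possibly with boundary: it is Hausdorff, second countable,
and every point has an open neighbourhood homeomorphic to an open subset of `ℝⁿ` or of a closed
coordinate half-space of `ℝⁿ`. For `n = 0` the second alternative is void, and for `n ≥ 1` all
coordinates `i` give homeomorphic half-spaces. -/
structure IsTopologicalManifold (n : ℕ) (M : Type*) [TopologicalSpace M] : Prop where
  t2 : T2Space M
  secondCountable : SecondCountableTopology M
  locallyEuclidean : ∀ p : M,
    (∃ e : OpenPartialHomeomorph M (EuclideanSpace ℝ (Fin n)), p ∈ e.source) ∨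
    (∃ i : Fin n, ∃ e : OpenPartialHomeomorph M {x : EuclideanSpace ℝ (Fin n) // 0 ≤ x i},
      p ∈ e.source)

universe u v

/-- `X` is an absolute neighbourhood retract: every continuous map to `X` from a closed subset `A`
of a paracompact Hausdorff space `P` extends continuously to an open neighbourhood of `A`.
The universe of `P` is independent of that of `X`. -/
def IsANR (X : Type u) [TopologicalSpace X] : Prop :=
  ∀ (P : Type v) [TopologicalSpace P] [T2Space P] [ParacompactSpace P] (A : Set P),
    IsClosed A → ∀ f : C(A, X),
      ∃ (W : Set P) (hAW : A ⊆ W), IsOpen W ∧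
        ∃ g : C(W, X), ∀ a : A, g ⟨a, hAW a.2⟩ = f a

/-- `X` has a closed embedding in `ℝᴺ` whose image is a retract of an open neighbourhood. -/
def IsENRIn (N : ℕ) (X : Type*) [TopologicalSpace X] : Prop :=
  ∃ ι : X → EuclideanSpace ℝ (Fin N), Topology.IsClosedEmbedding ι ∧
    ∃ (U : Set (EuclideanSpace ℝ (Fin N))) (hU : Set.range ι ⊆ U), IsOpen U ∧
      ∃ r : C(U, Set.range ι), ∀ y : Set.range ι, r ⟨y, hU y.2⟩ = y

/-- `X` is a Euclidean neighbourhood retract. -/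
def IsENR (X : Type*) [TopologicalSpace X] : Prop :=
  ∃ N : ℕ, IsENRIn N X

/-! A closed half-space is a retract of ℝⁿ, so boundary and interior points alike have open
neighbourhoods that are retracts of open subsets of ℝⁿ; nothing else about charts is used. ANR:
within one chart, Tietze's theorem extends the map. Second countability makes countably many charts
suffice, and the local extensions are performed in succession (`exists_extension_nhds_of_iUnion`).
Embedding: a proper map to a line in ℝ²ⁿ⁺¹ is perturbed by a bounded map, which preserves
properness. Separating two disjoint compact sets in charts is an open dense condition on the
perturbation, since a C¹ map from ℝⁿ × ℝⁿ to ℝ²ⁿ⁺¹ misses a dense set; by Baire, countably many such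
conditions hold at once and give injectivity. ENR: the ANR property extends the inverse of the
closed embedding. -/

/-! ### Retract charts -/

/-- An open subset `source` of `M` presented as a retract of an open subset `target` of `E`. -/
structure RetractChart (M E : Type*) [TopologicalSpace M] [TopologicalSpace E] where
  source : Set M
  target : Set E
  toFun : M → E
  invFun : E → M
  isOpen_source : IsOpen source
  isOpen_target : IsOpen target
  continuousOn_toFun : ContinuousOn toFun source
  continuousOn_invFun : ContinuousOn invFun target
  mapsTo_toFun : Set.MapsTo toFun source target
  mapsTo_invFun : Set.MapsTo invFun target source
  left_inv : ∀ x ∈ source, invFun (toFun x) = x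

/-- A chart with values in a retract `H` of `E` gives a retract chart with values in `E`. -/
def OpenPartialHomeomorph.toRetractChart {M H E : Type*} [TopologicalSpace M] [TopologicalSpace H]
    [TopologicalSpace E] (e : OpenPartialHomeomorph M H) (i : C(H, E)) (r : C(E, H))
    (hr : ∀ h, r (i h) = h) : RetractChart M E where
  source := e.source
  target := r ⁻¹' e.target
  toFun := fun x => i (e x)
  invFun := fun y => e.symm (r y)
  isOpen_source := e.open_source
  isOpen_target := e.open_target.preimage r.continuous
  continuousOn_toFun := i.continuous.comp_continuousOn e.continuousOn
  continuousOn_invFun := e.continuousOn_symm.comp r.continuous.continuousOn fun _ hy => hy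
  mapsTo_toFun := fun x hx => by
    simpa only [Set.mem_preimage, hr] using e.map_source hx
  mapsTo_invFun := fun y hy => e.map_target hy
  left_inv := fun x hx => by rw [hr, e.left_inv hx]

/-- The retraction of `ℝⁿ` onto a closed coordinate half-space. -/
noncomputable def halfSpaceRetraction {n : ℕ} (i : Fin n) :
    C(EuclideanSpace ℝ (Fin n), {x : EuclideanSpace ℝ (Fin n) // 0 ≤ x i}) where
  toFun x := ⟨x + EuclideanSpace.single i (max (x i) 0 - x i), by simp⟩
  continuous_toFun := by
    refine Continuous.subtype_mk (continuous_id.add ?_) _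
    have h : ∀ a : ℝ, EuclideanSpace.single i a = a • EuclideanSpace.single i (1 : ℝ) := by
      intro a; ext j; simp
    exact Continuous.congr (by fun_prop) fun x => (h (max (x i) 0 - x i)).symm

theorem halfSpaceRetraction_coe {n : ℕ} (i : Fin n)
    (x : {x : EuclideanSpace ℝ (Fin n) // 0 ≤ x i}) : halfSpaceRetraction i x = x := by
  apply Subtype.ext
  simp [halfSpaceRetraction, max_eq_left x.2]

theorem IsTopologicalManifold.exists_retractChart {n : ℕ} {M : Type*} [TopologicalSpace M]
    (hM : IsTopologicalManifold n M) (p : M) :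
    ∃ c : RetractChart M (EuclideanSpace ℝ (Fin n)), p ∈ c.source := by
  rcases hM.locallyEuclidean p with ⟨e, he⟩ | ⟨i, e, he⟩
  · exact ⟨e.toRetractChart (ContinuousMap.id _) (ContinuousMap.id _) fun _ => rfl, he⟩
  · exact ⟨e.toRetractChart ⟨Subtype.val, continuous_subtype_val⟩ (halfSpaceRetraction i)
      (halfSpaceRetraction_coe i), he⟩

theorem weaklyLocallyCompactSpace_of_retractChart {M E : Type*} [TopologicalSpace M]
    [TopologicalSpace E] [LocallyCompactSpace E]
    (hc : ∀ p : M, ∃ c : RetractChart M E, p ∈ c.source) : WeaklyLocallyCompactSpace M where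
  exists_compact_mem_nhds p := by
    obtain ⟨c, hp⟩ := hc p
    obtain ⟨K, hK, hpK, hKt⟩ := exists_compact_subset c.isOpen_target (c.mapsTo_toFun hp)
    refine ⟨c.invFun '' K, hK.image_of_continuousOn (c.continuousOn_invFun.mono hKt), ?_⟩
    filter_upwards [c.isOpen_source.mem_nhds hp,
      (c.continuousOn_toFun.continuousAt (c.isOpen_source.mem_nhds hp)).preimage_mem_nhds
        (isOpen_interior.mem_nhds hpK)] with x hx hxK
    exact ⟨_, interior_subset hxK, c.left_inv x hx⟩

/-! ### Neighbourhood extension of maps -/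

/-- A map on a closed set `Z` extends over a neighbourhood of a closed subset of `Z` that it sends
into the domain of a retract chart. -/
theorem RetractChart.exists_extension_nhds {M : Type*} {E : Type u} {P : Type v}
    [TopologicalSpace M] [TopologicalSpace E] [TietzeExtension.{v, u} E] [TopologicalSpace P]
    [NormalSpace P] (c : RetractChart M E) {Z C : Set P} (hZ : IsClosed Z) (hC : IsClosed C)
    (hCZ : C ⊆ Z) {F : P → M} (hF : ContinuousOn F Z) (hFC : Set.MapsTo F C c.source) :
    ∃ D : Set P, IsClosed D ∧ C ⊆ interior D ∧
      ∃ G : P → M, ContinuousOn G (Z ∪ D) ∧ Set.EqOn G F Z := by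
  classical
  obtain ⟨O, hO, hOZ⟩ := continuousOn_iff'.1 hF _ c.isOpen_source
  have hCO : C ⊆ O := fun x hx => (hOZ.subset ⟨hFC hx, hCZ hx⟩).1
  obtain ⟨O₁, hO₁, hCO₁, hO₁O⟩ := normal_exists_closure_subset hC hO hCO
  have hFB : Set.MapsTo F (closure O₁ ∩ Z) c.source :=
    fun x hx => (hOZ.superset ⟨hO₁O hx.1, hx.2⟩).1
  obtain ⟨h, hh⟩ := ContinuousMap.exists_restrict_eq (isClosed_closure.inter hZ)
    ⟨(closure O₁ ∩ Z).domRestrict (c.toFun ∘ F),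
      (c.continuousOn_toFun.comp (hF.mono Set.inter_subset_right) hFB).domRestrict⟩
  have hh' : ∀ x ∈ closure O₁ ∩ Z, h x = c.toFun (F x) := fun x hx => congr($hh ⟨x, hx⟩)
  -- On `closure O₂` the Tietze extension `h` stays in the target, so `c.invFun ∘ h` is continuous
  -- there; inside `O₁` it agrees with `F` on `Z`.
  obtain ⟨O₂, hO₂, hCO₂, hO₂O⟩ := normal_exists_closure_subset hC
    (hO₁.inter (c.isOpen_target.preimage h.continuous)) (fun x hx => ⟨hCO₁ hx, by
      rw [Set.mem_preimage, hh' x ⟨subset_closure (hCO₁ hx), hCZ hx⟩]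
      exact c.mapsTo_toFun (hFC hx)⟩)
  have hG : Set.EqOn (Z.piecewise F (c.invFun ∘ h)) F Z := Set.piecewise_eqOn _ _ _
  have hGD : Set.EqOn (Z.piecewise F (c.invFun ∘ h)) (c.invFun ∘ h) (closure O₂) := by
    intro x hx
    by_cases hxZ : x ∈ Z
    · have hxB : x ∈ closure O₁ ∩ Z := ⟨subset_closure (hO₂O hx).1, hxZ⟩
      rw [hG hxZ, Function.comp_apply, hh' x hxB, c.left_inv _ (hFB hxB)]
    · exact Set.piecewise_eq_of_notMem _ _ _ hxZ
  refine ⟨closure O₂, isClosed_closure, hCO₂.trans (interior_maximal subset_closure hO₂), _,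
    ContinuousOn.union_of_isClosed (hF.congr hG) (ContinuousOn.congr ?_ hGD) hZ isClosed_closure,
    hG⟩
  exact c.continuousOn_invFun.comp h.continuous.continuousOn fun x hx => (hO₂O hx).2

/-- A map on a closed set `A` extends over a neighbourhood of `A` if `A` is a countable union of
closed sets that are sent into the domains of retract charts. -/
theorem exists_extension_nhds_of_iUnion {M : Type*} {E : Type u} {P : Type v}
    [TopologicalSpace M] [TopologicalSpace E] [TietzeExtension.{v, u} E] [TopologicalSpace P]
    [NormalSpace P] {A : Set P} (hA : IsClosed A) {f : P → M} (hf : ContinuousOn f A)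
    (C : ℕ → Set P) (hC : ∀ k, IsClosed (C k)) (hAC : A = ⋃ k, C k)
    (c : ℕ → RetractChart M E) (hfC : ∀ k, Set.MapsTo f (C k) (c k).source) :
    ∃ W : Set P, IsOpen W ∧ A ⊆ W ∧ ∃ g : P → M, ContinuousOn g W ∧ Set.EqOn g f A := by
  classical
  let S := {s : Set P × (P → M) // IsClosed s.1 ∧ ContinuousOn s.2 (A ∪ s.1) ∧ Set.EqOn s.2 f A}
  have hCA : ∀ k, C k ⊆ A := fun k => hAC ▸ Set.subset_iUnion C k
  have step : ∀ (k : ℕ) (s : S), ∃ t : S, s.1.1 ⊆ t.1.1 ∧ C k ⊆ interior t.1.1 ∧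
      Set.EqOn t.1.2 s.1.2 (A ∪ s.1.1) := by
    rintro k ⟨⟨D, F⟩, hD, hF, hFf⟩
    obtain ⟨D', hD', hCD', G, hG, hGF⟩ := (c k).exists_extension_nhds (hA.union hD) (hC k)
      ((hCA k).trans Set.subset_union_left) hF
      (fun x hx => (hFf (hCA k hx)).symm ▸ hfC k hx)
    refine ⟨⟨(D ∪ D', G), hD.union hD', by simpa only [Set.union_assoc] using hG,
      fun x hx => (hGF (Or.inl hx)).trans (hFf hx)⟩, Set.subset_union_left,
      hCD'.trans (interior_mono Set.subset_union_right), hGF⟩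
  choose next hsub hCint heq using step
  let s : ℕ → S := fun k =>
    Nat.rec ⟨(∅, f), isClosed_empty, by simpa using hf, fun _ _ => rfl⟩ next k
  have hmono : Monotone fun k => (s k).1.1 := monotone_nat_of_le_succ fun k => hsub k (s k)
  have hcompat : ∀ j k, j ≤ k → Set.EqOn (s k).1.2 (s j).1.2 (A ∪ (s j).1.1) := by
    intro j k hjk
    induction k, hjk using Nat.le_induction with
    | base => exact fun _ _ => rfl
    | succ k hjk ih =>
      exact fun x hx => (heq k (s k) (Set.union_subset_union_right A (hmono hjk) hx)).trans (ih hx)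
  have hcompat' : ∀ j k x, x ∈ (s j).1.1 → x ∈ (s k).1.1 → (s j).1.2 x = (s k).1.2 x := by
    intro j k x hj hk
    rcases le_total j k with h | h
    · exact (hcompat j k h (Or.inr hj)).symm
    · exact hcompat k j h (Or.inr hk)
  -- The union of the closed stages need not be open, nor `g` continuous on it. On the union of
  -- their interiors, `g` locally equals a single stage.
  let g : P → M := fun x =>
    if h : ∃ k, x ∈ interior (s k).1.1 then (s h.choose).1.2 x else f x
  have hg : ∀ k, Set.EqOn g (s k).1.2 (interior (s k).1.1) := by
    intro k x hx
    have h : ∃ k, x ∈ interior (s k).1.1 := ⟨k, hx⟩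
    simp only [g, dif_pos h]
    exact hcompat' _ _ _ (interior_subset h.choose_spec) (interior_subset hx)
  have hAW : A ⊆ ⋃ k, interior (s k).1.1 := by
    intro x hx
    obtain ⟨k, hk⟩ := Set.mem_iUnion.1 (hAC.subset hx)
    exact Set.mem_iUnion.2 ⟨k + 1, hCint k (s k) hk⟩
  refine ⟨_, isOpen_iUnion fun k => isOpen_interior, hAW, g, ?_, ?_⟩
  · intro x hx
    obtain ⟨k, hk⟩ := Set.mem_iUnion.1 hx
    have hcont : ContinuousOn g (interior (s k).1.1) :=
      ((s k).2.2.1.mono (interior_subset.trans Set.subset_union_right)).congr (hg k)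
    exact (hcont.continuousAt (isOpen_interior.mem_nhds hk)).continuousWithinAt
  · intro x hx
    obtain ⟨k, hk⟩ := Set.mem_iUnion.1 (hAW hx)
    exact (hg k hk).trans ((s k).2.2.2 hx)

theorem isANR_of_retractChart {M : Type u} {E : Type*} [TopologicalSpace M] [TopologicalSpace E]
    [TietzeExtension.{v} E] [RegularSpace M] [SecondCountableTopology M]
    (hc : ∀ p : M, ∃ c : RetractChart M E, p ∈ c.source) : IsANR.{u, v} M := by
  classical
  intro P _ _ _ A hA f
  -- A point of `A` supplies the default value of `f'` off `A`.
  rcases A.eq_empty_or_nonempty with rfl | ⟨a₀, ha₀⟩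
  · exact ⟨∅, subset_rfl, isOpen_empty, ⟨fun x => x.2.elim, by
      rw [continuous_iff_continuousAt]; exact fun x => x.2.elim⟩, fun a => a.2.elim⟩
  choose c hcp using hc
  have hcl : ∀ p : M, ∃ F ∈ nhds p, IsClosed F ∧ F ⊆ (c p).source := fun p =>
    exists_mem_nhds_isClosed_subset ((c p).isOpen_source.mem_nhds (hcp p))
  choose F hFp hFcl hFc using hcl
  obtain ⟨s, hs, hsU⟩ := TopologicalSpace.countable_cover_nhds hFp
  have hs₀ : s.Nonempty := by
    obtain ⟨p, hp, -⟩ := Set.mem_iUnion₂.1 (hsU.symm.subset (Set.mem_univ (f ⟨a₀, ha₀⟩)))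
    exact ⟨p, hp⟩
  obtain ⟨p, rfl⟩ := hs.exists_eq_range hs₀
  let f' : P → M := fun x => if h : x ∈ A then f ⟨x, h⟩ else f ⟨a₀, ha₀⟩
  have hf' : ∀ a : A, f' a = f a := fun a => dif_pos a.2
  have hf'c : ContinuousOn f' A := by
    rw [continuousOn_iff_continuous_domRestrict]
    convert! f.continuous using 1
    exact funext hf'
  obtain ⟨W, hW, hAW, g, hg, hgf⟩ := exists_extension_nhds_of_iUnion hA hf'c
    (fun k => A ∩ f' ⁻¹' F (p k)) (fun k => hf'c.preimage_isClosed_of_isClosed hA (hFcl _))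
    (by
      rw [← Set.inter_iUnion, eq_comm, Set.inter_eq_left]
      intro x _
      simpa using hsU.symm.subset (Set.mem_univ (f' x)))
    (fun k => c (p k)) (fun k x hx => hFc _ hx.2)
  exact ⟨W, hAW, hW, ⟨W.domRestrict g, hg.domRestrict⟩, fun a => (hgf a.2).trans (hf' a)⟩

/-! ### General position and closed embeddings -/

open BoundedContinuousFunction in
/-- On a compact subset of the domain of a retract chart, continuous maps to a normed space are
uniformly approximated by smooth functions of the chart. -/
theorem RetractChart.exists_contDiff_dist_lt {M E F : Type*} [TopologicalSpace M]
    [NormedAddCommGroup E] [NormedSpace ℝ E] [FiniteDimensional ℝ E] [NormedAddCommGroup F]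
    [NormedSpace ℝ F] [FiniteDimensional ℝ F] (c : RetractChart M E) {K : Set M} (hK : IsCompact K)
    (hKc : K ⊆ c.source) (f : C(M, F)) {ε : ℝ} (hε : 0 < ε) :
    ∃ h : E → F, ContDiff ℝ 1 h ∧ ∀ x ∈ K, dist (h (c.toFun x)) (f x) < ε := by
  have hK' : IsCompact (c.toFun '' K) := hK.image_of_continuousOn (c.continuousOn_toFun.mono hKc)
  have : CompactSpace (c.toFun '' K) := isCompact_iff_compactSpace.1 hK'
  have hsub : c.toFun '' K ⊆ c.target := (c.mapsTo_toFun.mono_left hKc).image_subset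
  let q : C(c.toFun '' K, F) := ⟨(c.toFun '' K).domRestrict (f ∘ c.invFun),
    (f.continuous.comp_continuousOn (c.continuousOn_invFun.mono hsub)).domRestrict⟩
  obtain ⟨g, -, hg⟩ := exists_norm_eq_domRestrict_eq hK'.isClosed ℝ (mkOfCompact q)
  obtain ⟨h, hh, hhg, -⟩ := g.continuous.exists_contDiff_approx 1 (ε := fun _ => ε)
    continuous_const fun _ => hε
  refine ⟨h, hh, fun x hx => ?_⟩
  have hgx : g (c.toFun x) = f x := by
    have : g (c.toFun x) = f (c.invFun (c.toFun x)) := congr($hg ⟨_, x, hx, rfl⟩)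
    rw [this, c.left_inv x (hKc hx)]
  simpa only [hgx] using hhg (c.toFun x)

open BoundedContinuousFunction in
/-- Two disjoint compact sets in chart domains have disjoint images after a small perturbation of a
map to a space of more than twice the dimension. -/
theorem exists_disjoint_image_add {M E F : Type*} [TopologicalSpace M] [T2Space M] [NormalSpace M]
    [NormedAddCommGroup E] [NormedSpace ℝ E] [FiniteDimensional ℝ E] [NormedAddCommGroup F]
    [NormedSpace ℝ F] [FiniteDimensional ℝ F]
    (hEF : 2 * Module.finrank ℝ E < Module.finrank ℝ F) (c c' : RetractChart M E) {K K' : Set M}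
    (hK : IsCompact K) (hK' : IsCompact K') (hKc : K ⊆ c.source) (hKc' : K' ⊆ c'.source)
    (hd : Disjoint K K') (f : C(M, F)) {ε : ℝ} (hε : 0 < ε) :
    ∃ g : M →ᵇ F, ‖g‖ ≤ ε ∧ Disjoint ((fun x => f x + g x) '' K) ((fun x => f x + g x) '' K') := by
  classical
  obtain ⟨h, hh, hhf⟩ := c.exists_contDiff_dist_lt hK hKc f (half_pos hε)
  obtain ⟨h', hh', hhf'⟩ := c'.exists_contDiff_dist_lt hK' hKc' f (half_pos hε)
  -- If `v` is not a value of `h z.1 - h' z.2`, then `h - v` and `h'` have no common value. The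
  -- approximation and `v` each cost at most `ε / 2`.
  have hdense : Dense (Set.range fun z : E × E => h z.1 - h' z.2)ᶜ := by
    apply ContDiff.dense_compl_range_of_finrank_lt_finrank
    · exact (hh.comp contDiff_fst).sub (hh'.comp contDiff_snd)
    · rwa [Module.finrank_prod, ← two_mul]
  obtain ⟨v, hv, hvε⟩ := hdense.exists_dist_lt (0 : F) (half_pos hε)
  rw [dist_zero_left] at hvε
  let d : M → F := K.piecewise (fun x => h (c.toFun x) - v - f x) fun x => h' (c'.toFun x) - f x
  have hdK : Set.EqOn d (fun x => h (c.toFun x) - v - f x) K := Set.piecewise_eqOn _ _ _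
  have hdK' : Set.EqOn d (fun x => h' (c'.toFun x) - f x) K' := fun x hx =>
    Set.piecewise_eq_of_notMem _ _ _ (hd.notMem_of_mem_right hx)
  have hdc : ContinuousOn d (K ∪ K') := by
    refine ContinuousOn.union_of_isClosed (ContinuousOn.congr ?_ hdK) (ContinuousOn.congr ?_ hdK')
      hK.isClosed hK'.isClosed
    · exact ((hh.continuous.comp_continuousOn (c.continuousOn_toFun.mono hKc)).sub
        continuousOn_const).sub f.continuous.continuousOn
    · exact (hh'.continuous.comp_continuousOn (c'.continuousOn_toFun.mono hKc')).sub
        f.continuous.continuousOn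
  have : CompactSpace ↥(K ∪ K') := isCompact_iff_compactSpace.1 (hK.union hK')
  -- The norm-preserving Tietze extension reduces the bound on `g` to one on `K ∪ K'`.
  obtain ⟨g, hgn, hg⟩ := exists_norm_eq_domRestrict_eq (hK.union hK').isClosed ℝ
    (mkOfCompact ⟨(K ∪ K').domRestrict d, hdc.domRestrict⟩)
  have hgd : ∀ x ∈ K ∪ K', g x = d x := fun x hx => congr($hg ⟨x, hx⟩)
  refine ⟨g, ?_, ?_⟩
  · rw [hgn, norm_le hε.le]
    rintro ⟨x, hx | hx⟩
    · change ‖d x‖ ≤ ε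
      have h₁ := hhf x hx
      rw [dist_eq_norm] at h₁
      rw [hdK hx]
      beta_reduce
      rw [sub_right_comm]
      exact (norm_sub_le _ _).trans (by linarith)
    · change ‖d x‖ ≤ ε
      have h₁ := hhf' x hx
      rw [dist_eq_norm] at h₁
      rw [hdK' hx]
      beta_reduce
      linarith
  · rw [Set.disjoint_left]
    rintro _ ⟨x, hx, rfl⟩ ⟨y, hy, hxy⟩
    refine hv ⟨(c.toFun x, c'.toFun y), ?_⟩
    simp only [hgd x (Or.inl hx), hgd y (Or.inr hy), hdK hx, hdK' hy, add_sub_cancel] at hxy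
    simp [hxy]

-- Disjoint compact images have disjoint `δ`-thickenings, which absorb any change of `g` by less
-- than `δ`.
open BoundedContinuousFunction in
theorem isOpen_setOf_disjoint_image_add {M F : Type*} [TopologicalSpace M] [NormedAddCommGroup F]
    (f : C(M, F)) {K K' : Set M} (hK : IsCompact K) (hK' : IsCompact K') :
    IsOpen {g : M →ᵇ F |
      Disjoint ((fun x => f x + g x) '' K) ((fun x => f x + g x) '' K')} := by
  rw [Metric.isOpen_iff]
  intro g hg
  have hc : Continuous fun x => f x + g x := f.continuous.add g.continuous
  obtain ⟨δ, hδ, hdis⟩ := Disjoint.exists_thickenings hg (hK.image hc) (hK'.image hc).isClosed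
  refine ⟨δ, hδ, fun g' hg' => hdis.mono ?_ ?_⟩ <;>
  · rintro _ ⟨x, hx, rfl⟩
    refine Metric.mem_thickening_iff.2 ⟨_, ⟨x, hx, rfl⟩, ?_⟩
    rw [dist_add_left]
    exact (dist_coe_le_dist x).trans_lt hg'

/-- Near `x` the index is at most `K.find x + 1`, as each compact set lies in the interior of the
next. Half-lines are convex, so a partition of unity glues these local bounds. -/
theorem CompactExhaustion.exists_continuous_find_le {X : Type*} [TopologicalSpace X] [NormalSpace X]
    [ParacompactSpace X] (K : CompactExhaustion X) :
    ∃ ρ : C(X, ℝ), ∀ x, (K.find x : ℝ) ≤ ρ x := by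
  refine exists_continuous_forall_mem_convex_of_local_const (t := fun x => Set.Ici (K.find x : ℝ))
    (fun x => convex_Ici _) fun x => ⟨(K.find x + 1 : ℕ), ?_⟩
  filter_upwards [isOpen_interior.mem_nhds (K.subset_interior_succ _ (K.mem_find x))] with y hy
  exact Set.mem_Ici.2 (Nat.cast_le.2 (K.mem_iff_find_le.1 (interior_subset hy)))

open BoundedContinuousFunction in
/-- A separable locally compact space covered by retract charts in `E` has a closed embedding in
every space of more than twice the dimension of `E`. -/
theorem exists_isClosedEmbedding_of_retractChart {M E F : Type*} [TopologicalSpace M] [T2Space M]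
    [LocallyCompactSpace M] [SecondCountableTopology M]
    [NormedAddCommGroup E] [NormedSpace ℝ E] [FiniteDimensional ℝ E] [NormedAddCommGroup F]
    [NormedSpace ℝ F] [FiniteDimensional ℝ F]
    (hEF : 2 * Module.finrank ℝ E < Module.finrank ℝ F)
    (hc : ∀ p : M, ∃ c : RetractChart M E, p ∈ c.source) :
    ∃ ι : M → F, Topology.IsClosedEmbedding ι := by
  have : CompleteSpace F := FiniteDimensional.complete ℝ F
  have : ProperSpace F := FiniteDimensional.proper ℝ F
  have : Nontrivial F := Module.nontrivial_of_finrank_pos (R := ℝ) (by omega)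
  obtain ⟨e, he⟩ := exists_norm_eq F zero_le_one
  let K : CompactExhaustion M := default
  obtain ⟨ρ, hρ⟩ := K.exists_continuous_find_le
  let f : C(M, F) := ⟨fun x => ρ x • e, by fun_prop⟩
  let B := TopologicalSpace.countableBasis M
  let good : Set M → Prop := fun s =>
    IsCompact (closure s) ∧ ∃ c : RetractChart M E, closure s ⊆ c.source
  let I := {p : B × B //
    good p.1.1 ∧ good p.2.1 ∧ Disjoint (closure p.1.1) (closure p.2.1)}
  have : Countable B := (TopologicalSpace.countable_countableBasis M).to_subtype
  let G : I → Set (M →ᵇ F) := fun p => {g | Disjoint ((fun x => f x + g x) '' closure p.1.1.1)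
    ((fun x => f x + g x) '' closure p.1.2.1)}
  have hGo : ∀ p, IsOpen (G p) := fun p =>
    isOpen_setOf_disjoint_image_add f p.2.1.1 p.2.2.1.1
  have hGd : ∀ p, Dense (G p) := by
    intro p
    obtain ⟨⟨hK, c, hKc⟩, ⟨hK', c', hKc'⟩, hd⟩ := p.2
    refine Metric.dense_iff.2 fun g ε hε => ?_
    obtain ⟨g', hg', hdis⟩ := exists_disjoint_image_add hEF c c' hK hK' hKc hKc' hd
      (f + g.toContinuousMap) (half_pos hε)
    refine ⟨g + g', ?_, ?_⟩
    · rw [Metric.mem_ball, dist_self_add_left]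
      linarith
    · simpa [G, add_assoc] using hdis
  -- Baire's theorem applies: `M →ᵇ F` is complete and `I` is countable.
  obtain ⟨g, hg⟩ := (dense_iInter_of_isOpen hGo hGd).nonempty
  rw [Set.mem_iInter] at hg
  have hcont : Continuous fun x => f x + g x := f.continuous.add g.continuous
  have hnhds : ∀ (x : M) (O : Set M), IsOpen O → x ∈ O →
      ∃ b : B, x ∈ b.1 ∧ good b.1 ∧ closure b.1 ⊆ O := by
    intro x O hO hx
    obtain ⟨c, hxc⟩ := hc x
    obtain ⟨Q, hQ, hxQ, hQO⟩ := exists_compact_subset (hO.inter c.isOpen_source) ⟨hx, hxc⟩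
    obtain ⟨b, hb, hxb, hbQ⟩ := (TopologicalSpace.isBasis_countableBasis M).exists_subset_of_mem_open
      hxQ isOpen_interior
    have hcl : closure b ⊆ Q := closure_minimal (hbQ.trans interior_subset) hQ.isClosed
    exact ⟨⟨b, hb⟩, hxb, ⟨hQ.of_isClosed_subset isClosed_closure hcl, c,
      fun y hy => (hQO (hcl hy)).2⟩, fun y hy => (hQO (hcl hy)).1⟩
  have hinj : Function.Injective fun x => f x + g x := by
    intro x y hxy
    by_contra hne
    obtain ⟨O, O', hO, hO', hxO, hyO', hOO'⟩ := t2_separation hne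
    obtain ⟨b, hxb, hb, hbO⟩ := hnhds x O hO hxO
    obtain ⟨b', hyb', hb', hbO'⟩ := hnhds y O' hO' hyO'
    exact Set.disjoint_left.1 (hg ⟨(b, b'), hb, hb', hOO'.mono hbO hbO'⟩)
      ⟨x, subset_closure hxb, rfl⟩ ⟨y, subset_closure hyb', hxy.symm⟩
  have hproper : IsProperMap fun x => f x + g x := by
    refine isProperMap_iff_isCompact_preimage.2 ⟨hcont, fun Q hQ => ?_⟩
    obtain ⟨R, hR⟩ := hQ.isBounded.exists_norm_le
    -- As `‖e‖ = 1`, a value of norm at most `R` forces `K.find x ≤ ρ x ≤ R + ‖g‖`.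
    obtain ⟨m, hm⟩ := exists_nat_ge (R + ‖g‖)
    refine (K.isCompact m).of_isClosed_subset (hQ.isClosed.preimage hcont) fun x hx => ?_
    rw [K.mem_iff_find_le, ← Nat.cast_le (α := ℝ)]
    have h₁ : ‖ρ x • e‖ ≤ ‖ρ x • e + g x‖ + ‖g x‖ := norm_le_add_norm_add _ _
    have h₂ : ‖ρ x • e + g x‖ ≤ R := hR _ hx
    have h₃ := g.norm_coe_le_norm x
    have h₄ := le_abs_self (ρ x)
    rw [norm_smul, he, mul_one, Real.norm_eq_abs] at h₁
    linarith [hρ x]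
  exact ⟨_, .of_continuous_injective_isClosedMap hcont hinj hproper.isClosedMap⟩

theorem IsANR.isENRIn_of_isClosedEmbedding {N : ℕ} {X : Type u} [TopologicalSpace X]
    (hX : IsANR.{u, 0} X) {ι : X → EuclideanSpace ℝ (Fin N)}
    (hι : Topology.IsClosedEmbedding ι) : IsENRIn N X := by
  let e := hι.isEmbedding.toHomeomorph
  obtain ⟨W, hW, hWo, g, hg⟩ := hX _ (Set.range ι) hι.isClosed_range ⟨e.symm, e.symm.continuous⟩
  refine ⟨ι, hι, W, hW, hWo, ⟨fun w => e (g w), e.continuous.comp g.continuous⟩, fun y => ?_⟩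
  change e (g _) = y
  rw [hg y]
  exact e.apply_symm_apply y

theorem corollary4p6 {n : ℕ} {M : Type u} [TopologicalSpace M]
    (hM : IsTopologicalManifold n M) :
    IsANR.{u, v} M ∧ IsENR M ∧ IsENRIn (2 * n + 1) M := by
  have := hM.t2
  have := hM.secondCountable
  have hc := hM.exists_retractChart
  have := weaklyLocallyCompactSpace_of_retractChart hc
  obtain ⟨ι, hι⟩ := exists_isClosedEmbedding_of_retractChart
    (F := EuclideanSpace ℝ (Fin (2 * n + 1))) (by simp) hc
  have hENR := (isANR_of_retractChart hc).isENRIn_of_isClosedEmbedding hι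
  exact ⟨isANR_of_retractChart hc, ⟨_, hENR⟩, hENR⟩
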